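/- Let $(X,\mu)$ be a standard Borel probability space. Let $G_{\mathrm{mp}}(X,\mu)$ be the group of Borel bijections $\varphi:X\to X$ with $\mu(\varphi^{-1}(A))=\mu(A)$ for all Borel $A\subseteq X$, let $I_{\mathrm{mp}}(X,\mu)$ be its normal subgroup of those $\varphi$ with $\varphi(x)=x$ for $\mu$-almost every $x$, put $\mathrm{Aut}(X,\mu)=G_{\mathrm{mp}}(X,\mu)/I_{\mathrm{mp}}(X,\mu)$, and let $\bar\varphi:G_{\mathrm{mp}}(X,\mu)\to\mathrm{Aut}(X,\mu)$ be the canonical homomorphism. A measure preserving (m.p.) near-action of a group $G$ on $(X,\mu)$ is a map $\eta:G\times X\to X$, written $\eta(g)(x)=\eta(g,x)$, such that (1) $\eta(e)(x)=x$ for almost all $x$, where $e$ is the identity of $G$; (2) for all $g,h\in G$, $\eta(gh)(x)=\eta(g)(\eta(h)(x))$ for almost all $x$; (3) for all $g\in G$ and all Borel $B\subseteq X$, the set $\eta(g)(B)$ is $\mu$-measurable and $\mu(\eta(g)(B))=\mu(B)$. A m.p. spatial action is an action $\rho:G\times X\to X$ of $G$ on the set $X$ in the usual sense that satisfies (3).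 It acts by Borel automorphisms if $x\mapsto\rho(g,x)$ is Borel for every $g\in G$. It is a spatial model of $\eta$ if for every $g\in G$, $\eta(g,x)=\rho(g,x)$ for $\mu$-almost every $x$. Theorem. Let $G$ be a group of cardinality at most $\aleph_1$. Then every m.p. near-action of $G$ on $(X,\mu)$ has a spatial model that acts by Borel m.p. automorphisms. Equivalently, for every homomorphism $f:G\to\mathrm{Aut}(X,\mu)$ there is a homomorphism $h:G\to G_{\mathrm{mp}}(X,\mu)$ such that $\bar\varphi\circ h=f$. (For each group $G$, of any cardinality, the assertion about all near-actions of $G$ on $(X,\mu)$ and the assertion about all homomorphisms $G\to\mathrm{Aut}(X,\mu)$ are equivalent.) In particular, if the Continuum Hypothesis holds, then every m.p. near-action of any group on $(X,\mu)$ has a spatial model that acts by Borel m.p. automorphisms. -/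

import Mathlib

open MeasureTheory

namespace NearAction

section Groups

variable {X : Type*} [MeasurableSpace X] [StandardBorelSpace X]

/-- The group `G_mp(X, μ)` of measure preserving Borel bijections of `X`. (Inverses of Borel
bijections of a standard Borel space are Borel.) -/
def Gmp (μ : Measure X) : Subgroup (Equiv.Perm X) where
  carrier := {f | MeasurePreserving f μ μ}
  one_mem' := MeasurePreserving.id μ
  mul_mem' := by
    intro f g hf hg
    have hf' : MeasurePreserving f μ μ := hf
    have hg' : MeasurePreserving g μ μ := hg
    exact hf'.comp hg'
  inv_mem' := by
    intro f hf
    have hf' : MeasurePreserving f μ μ := hf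
    have he : MeasurableEmbedding f := hf'.measurable.measurableEmbedding f.injective
    have hm : Measurable f.symm := by
      intro s hs
      rw [← Equiv.image_eq_preimage_symm]
      exact he.measurableSet_image.2 hs
    exact MeasurePreserving.symm (e := ⟨f, hf'.measurable, hm⟩) hf'

/-- The subgroup `I_mp(X, μ)` of those measure preserving Borel bijections that fix almost every
point. -/
def Imp (μ : Measure X) : Subgroup (Gmp μ) where
  carrier := {f | ∀ᵐ x ∂μ, f.1 x = x}
  one_mem' := by
    show ∀ᵐ x ∂μ, (1 : Gmp μ).1 x = x
    exact Filter.Eventually.of_forall fun _ => rfl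
  mul_mem' := by
    intro f g hf hg
    have hf' : ∀ᵐ x ∂μ, f.1 x = x := hf
    have hg' : ∀ᵐ x ∂μ, g.1 x = x := hg
    show ∀ᵐ x ∂μ, f.1 (g.1 x) = x
    filter_upwards [hf', hg'] with x h1 h2
    rw [h2, h1]
  inv_mem' := by
    intro f hf
    have hf' : ∀ᵐ x ∂μ, f.1 x = x := hf
    show ∀ᵐ x ∂μ, f.1.symm x = x
    filter_upwards [hf'] with x h
    rw [Equiv.symm_apply_eq, h]

instance Imp_normal (μ : Measure X) : (Imp μ).Normal where
  conj_mem := by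
    intro n hn g
    have hn' : ∀ᵐ x ∂μ, n.1 x = x := hn
    have hg : MeasurePreserving g.1.symm μ μ := (g⁻¹ : Gmp μ).2
    show ∀ᵐ x ∂μ, g.1 (n.1 (g.1.symm x)) = x
    filter_upwards [hg.quasiMeasurePreserving.ae hn'] with x h
    have h' : n.1 (g.1.symm x) = g.1.symm x := h
    rw [h', Equiv.apply_symm_apply]

/-- The group `Aut(X, μ) = G_mp(X, μ) / I_mp(X, μ)` of measure preserving transformations. -/
abbrev Aut (μ : Measure X) : Type _ := Gmp μ ⧸ Imp μ

/-- The canonical homomorphism of `G_mp(X, μ)` onto `Aut(X, μ)`. -/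
abbrev toAut (μ : Measure X) : Gmp μ →* Aut μ := QuotientGroup.mk' (Imp μ)

end Groups

section Actions

variable {G : Type*} [Group G] {X : Type*} [MeasurableSpace X]

/-- `η` is a measure preserving near-action of `G` on `(X, μ)`. -/
structure IsNearAction (μ : Measure X) (η : G → X → X) : Prop where
  one_ae : ∀ᵐ x ∂μ, η 1 x = x
  mul_ae : ∀ g h : G, ∀ᵐ x ∂μ, η (g * h) x = η g (η h x)
  nullMeasurableSet_image : ∀ (g : G) (B : Set X), MeasurableSet B →
    NullMeasurableSet (η g '' B) μ
  measure_image : ∀ (g : G) (B : Set X), MeasurableSet B → μ (η g '' B) = μ B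

/-- `ρ` is a measure preserving spatial action of `G` on `(X, μ)`. -/
structure IsSpatialAction (μ : Measure X) (ρ : G → X → X) : Prop where
  one_apply : ∀ x : X, ρ 1 x = x
  mul_apply : ∀ (g h : G) (x : X), ρ (g * h) x = ρ g (ρ h x)
  nullMeasurableSet_image : ∀ (g : G) (B : Set X), MeasurableSet B →
    NullMeasurableSet (ρ g '' B) μ
  measure_image : ∀ (g : G) (B : Set X), MeasurableSet B → μ (ρ g '' B) = μ B

/-- `ρ` is a spatial model of `η`. -/
structure IsSpatialModel (μ : Measure X) (η ρ : G → X → X) : Prop where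
  isSpatialAction : IsSpatialAction μ ρ
  ae_eq : ∀ g : G, ∀ᵐ x ∂μ, η g x = ρ g x

/-- `η` has a spatial model that acts by Borel measure preserving automorphisms. -/
def HasSpatialModelByBorelAutomorphisms (μ : Measure X) (η : G → X → X) : Prop :=
  ∃ ρ : G → X → X, IsSpatialModel μ η ρ ∧ ∀ g : G, Measurable (ρ g)

end Actions

end NearAction

/-! For a countable group, any choice of representatives is an action on an invariant conull Borel
set. For cardinality `ℵ₁` the lift is built along a chain of countable subgroups, and the difficulty
is to extend a lift from `H` to a countable `K > H`: the action of `H` on the exceptional null set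
must itself extend to `K`.

If a Borel action of `H` contains a copy of the shift on `H → ℝ`, equivariant Schröder-Bernstein
identifies it with the restriction to `H` of the shift on `K → ℝ`, so it extends
(`exists_measurableEquiv_shift`). A reserve of such copies must survive every stage, limits
included. A null copy of `Param × (ℕ → ℝ)` provides it. Each parameter assigns to every group
element a map `ℕ → ℕ`, and a lift to `H` is required to permute coordinates in the fibres where
these maps form an action of `H`. This locus shrinks as `H` grows, so the requirement passes to
unions. If `a ∈ K \ H`, independence of the maps (`exists_independent_family`) gives a parameter in
the locus of `H` but not of `K` (`exists_regular_param`); its fibre contains the shift of `H` and is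
free for use in `exists_extension`.

Zorn's lemma completes the construction when `X` is uncountable. Countable `X` is handled by its
atoms, and CH reduces to the `ℵ₁` case because `Aut μ` has at most continuum many elements. -/

namespace NearAction

/-! ### Shifts and equivariant Schröder-Bernstein -/

section EquivariantEmbeddings

/-- The right shift of a group `M` on the space of real valued functions on `M`. -/
def shift (M : Type*) [Group M] : M →* Equiv.Perm (M → ℝ) where
  toFun g :=
    { toFun := fun x k => x (k * g)
      invFun := fun x k => x (k * g⁻¹)
      left_inv := fun x => by funext k; simp
      right_inv := fun x => by funext k; simp }
  map_one' := by ext x k; simp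
  map_mul' g h := by ext x k; simp [mul_assoc]

@[simp] lemma shift_apply {M : Type*} [Group M] (g : M) (x : M → ℝ) (k : M) :
    shift M g x k = x (k * g) := rfl

lemma measurable_shift {M : Type*} [Group M] (g : M) : Measurable (shift M g) :=
  measurable_pi_lambda _ fun k => measurable_pi_apply (k * g)

/-- Every action by Borel maps on a standard Borel space embeds into the shift. -/
lemma exists_embedding_shift {M A : Type*} [Group M] [MeasurableSpace A] [StandardBorelSpace A]
    (a : M →* Equiv.Perm A) (ha : ∀ g, Measurable (a g)) :
    ∃ u : A → M → ℝ, Measurable u ∧ Function.Injective u ∧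
      ∀ g x, u (a g x) = shift M g (u x) := by
  -- Record real codes of the whole orbit; the coordinate at `1` recovers the point.
  refine ⟨fun x k => embeddingReal A (a k x), ?_, ?_, ?_⟩
  · exact measurable_pi_lambda _ fun k =>
      (measurableEmbedding_embeddingReal A).measurable.comp (ha k)
  · intro x y hxy
    have := congrFun hxy 1
    simpa using (measurableEmbedding_embeddingReal A).injective this
  · intro g x
    funext k
    simp [map_mul]

/-- The shift of a group embeds equivariantly into the shift of a larger group. -/
lemma exists_shift_embedding_shift {M K : Type*} [Group M] [Group K] (j : M →* K)
    (hj : Function.Injective j) :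
    ∃ u : (M → ℝ) → K → ℝ, Measurable u ∧ Function.Injective u ∧
      ∀ g x, u (shift M g x) = shift K (j g) (u x) := by
  classical
  -- Extension by zero is equivariant because right multiplication by `j g` preserves the range of
  -- `j` and its complement.
  refine ⟨fun x => Function.extend j x 0, ?_, ?_, ?_⟩
  · refine measurable_pi_lambda _ fun k => ?_
    by_cases hk : ∃ m, j m = k
    · obtain ⟨m, rfl⟩ := hk
      simpa only [hj.extend_apply] using measurable_pi_apply m
    · simp only [Function.extend_apply' _ _ _ hk]
      exact measurable_const
  · intro x y hxy
    funext m
    have := congrFun hxy (j m)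
    simpa only [hj.extend_apply] using this
  · intro g x
    funext k
    show Function.extend j (shift M g x) 0 k = Function.extend j x 0 (k * j g)
    by_cases hk : ∃ m, j m = k
    · obtain ⟨m, rfl⟩ := hk
      rw [← map_mul, hj.extend_apply, hj.extend_apply, shift_apply]
    · have hk' : ¬ ∃ m, j m = k * j g := by
        rintro ⟨m, hm⟩
        exact hk ⟨m * g⁻¹, by simp [hm]⟩
      rw [Function.extend_apply' _ _ _ hk, Function.extend_apply' _ _ _ hk']
      rfl

/-- The equivariant Borel Schröder-Bernstein theorem. -/
lemma exists_equivariant_measurableEquiv {M A B : Type*} [Group M]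
    [MeasurableSpace A] [StandardBorelSpace A] [MeasurableSpace B] [StandardBorelSpace B]
    (a : M →* Equiv.Perm A) (b : M →* Equiv.Perm B)
    {u : A → B} (hu : Measurable u) (hui : Function.Injective u)
    (hua : ∀ g x, u (a g x) = b g (u x))
    {v : B → A} (hv : Measurable v) (hvi : Function.Injective v)
    (hva : ∀ g y, v (b g y) = a g (v y)) :
    ∃ e : A → B, MeasurableEmbedding e ∧ Function.Surjective e ∧
      ∀ g x, e (a g x) = b g (e x) := by
  classical
  have hu' := hu.measurableEmbedding hui
  have hv' := hv.measurableEmbedding hvi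
  -- The classical back-and-forth: `e` is `u` on the union `C` of these sets and the inverse of `v`
  -- off it. Each `T n` is invariant, which makes `e` equivariant.
  let T : ℕ → Set A := fun n => Nat.rec (Set.range v)ᶜ (fun _ S => v '' (u '' S)) n
  have hT0 : T 0 = (Set.range v)ᶜ := rfl
  have hTs : ∀ n, T (n + 1) = v '' (u '' T n) := fun n => rfl
  have hTm : ∀ n, MeasurableSet (T n) := by
    intro n
    induction n with
    | zero => rw [hT0]; exact hv'.measurableSet_range.compl
    | succ n ih =>
      rw [hTs]; exact hv'.measurableSet_image.2 (hu'.measurableSet_image.2 ih)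
  have hTa : ∀ n g x, x ∈ T n → a g x ∈ T n := by
    intro n
    induction n with
    | zero =>
      rw [hT0]
      rintro g x hx ⟨y, hy⟩
      refine hx ⟨b g⁻¹ y, ?_⟩
      rw [hva, hy, ← Equiv.Perm.mul_apply, ← map_mul]
      simp
    | succ n ih =>
      rw [hTs]
      rintro g _ ⟨_, ⟨x, hx, rfl⟩, rfl⟩
      exact ⟨_, ⟨_, ih g x hx, rfl⟩, by rw [hua, hva]⟩
  let C : Set A := ⋃ n, T n
  have hCm : MeasurableSet C := MeasurableSet.iUnion hTm
  have hCa : ∀ g x, a g x ∈ C ↔ x ∈ C := by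
    have key : ∀ g x, x ∈ C → a g x ∈ C := by
      intro g x hx
      obtain ⟨n, hn⟩ := Set.mem_iUnion.1 hx
      exact Set.mem_iUnion.2 ⟨n, hTa n g x hn⟩
    refine fun g x => ⟨fun h => ?_, key g x⟩
    have := key g⁻¹ _ h
    rwa [← Equiv.Perm.mul_apply, ← map_mul, inv_mul_cancel, map_one] at this
  have hCr : ∀ x, x ∉ C → ∃ y, v y = x := by
    intro x hx
    by_contra h
    exact hx (Set.mem_iUnion.2 ⟨0, h⟩)
  have hCv : ∀ x ∈ C, v (u x) ∈ C := by
    intro x hx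
    obtain ⟨n, hn⟩ := Set.mem_iUnion.1 hx
    exact Set.mem_iUnion.2 ⟨n + 1, ⟨_, ⟨x, hn, rfl⟩, rfl⟩⟩
  have hCv' : ∀ y, v y ∈ C → ∃ x ∈ C, u x = y := by
    intro y hy
    obtain ⟨n, hn⟩ := Set.mem_iUnion.1 hy
    cases n with
    | zero => exact absurd ⟨y, rfl⟩ hn
    | succ n =>
      obtain ⟨_, ⟨x, hx, rfl⟩, hxy⟩ := hn
      exact ⟨x, Set.mem_iUnion.2 ⟨n, hx⟩, hvi hxy⟩
  let e : A → B := fun x => if h : x ∈ C then u x else (hCr x h).choose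
  have he1 : ∀ x ∈ C, e x = u x := fun x hx => dif_pos hx
  have he2 : ∀ x, x ∉ C → v (e x) = x := fun x hx => by
    simp only [e, dif_neg hx]
    exact (hCr x hx).choose_spec
  have hinj : Function.Injective e := by
    intro x y hxy
    by_cases hx : x ∈ C <;> by_cases hy : y ∈ C
    · rw [he1 x hx, he1 y hy] at hxy; exact hui hxy
    · refine absurd (hCv x hx) ?_
      rw [← he1 x hx, hxy, he2 y hy]; exact hy
    · refine absurd (hCv y hy) ?_
      rw [← he1 y hy, ← hxy, he2 x hx]; exact hx
    · rw [← he2 x hx, ← he2 y hy, hxy]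
  have hsurj : Function.Surjective e := by
    intro y
    by_cases hy : v y ∈ C
    · obtain ⟨x, hx, rfl⟩ := hCv' y hy
      exact ⟨x, he1 x hx⟩
    · exact ⟨v y, hvi (he2 _ hy)⟩
  have hmeas : Measurable e := by
    intro S hS
    have : e ⁻¹' S = (C ∩ u ⁻¹' S) ∪ (Cᶜ ∩ v '' S) := by
      ext x
      by_cases hx : x ∈ C
      · simp [hx, he1 x hx]
      · simp only [Set.mem_preimage, Set.mem_union, Set.mem_inter_iff, hx, false_and, false_or,
          Set.mem_compl_iff, not_false_eq_true, true_and]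
        refine ⟨fun h => ⟨e x, h, he2 x hx⟩, ?_⟩
        rintro ⟨y, hy, hyx⟩
        have : e x = y := hvi (by rw [he2 x hx, hyx])
        rwa [this]
    rw [this]
    exact (hCm.inter (hu hS)).union (hCm.compl.inter (hv'.measurableSet_image.2 hS))
  refine ⟨e, hmeas.measurableEmbedding hinj, hsurj, fun g x => ?_⟩
  by_cases hx : x ∈ C
  · rw [he1 x hx, he1 _ ((hCa g x).2 hx), hua]
  · apply hvi
    rw [he2 _ (fun h => hx ((hCa g x).1 h)), hva, he2 x hx]

/-- A Borel action of a countable group that contains the shift is isomorphic to the restriction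
of the shift of any larger countable group. -/
lemma exists_measurableEquiv_shift {M K N : Type*} [Group M] [Countable M] [Group K] [Countable K]
    [MeasurableSpace N] [StandardBorelSpace N] (j : M →* K) (hj : Function.Injective j)
    (a : M →* Equiv.Perm N) (ha : ∀ g, Measurable (a g))
    {w : (M → ℝ) → N} (hw : Measurable w) (hwi : Function.Injective w)
    (hwa : ∀ g x, w (shift M g x) = a g (w x)) :
    ∃ e : (K → ℝ) → N, MeasurableEmbedding e ∧ Function.Surjective e ∧
      ∀ g x, e (shift K (j g) x) = a g (e x) := by
  obtain ⟨u, hu, hui, hua⟩ := exists_embedding_shift a ha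
  obtain ⟨t, ht, hti, hta⟩ := exists_shift_embedding_shift j hj
  obtain ⟨s, hs, hsi, hsa⟩ := exists_embedding_shift ((shift K).comp j)
    (fun g => measurable_shift (j g))
  refine exists_equivariant_measurableEquiv ((shift K).comp j) a
    (u := w ∘ s) (hw.comp hs) (hwi.comp hsi) ?_ (v := t ∘ u) (ht.comp hu) (hti.comp hui) ?_
  · intro g x
    simp only [Function.comp_apply, hsa, hwa]
  · intro g x
    simp only [Function.comp_apply, hua, hta, MonoidHom.comp_apply]

end EquivariantEmbeddings

/-! ### An independent family of Borel maps -/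

section IndependentFamily

/-- There is a continuum sized family of Borel maps into `ℕ → ℕ`, on a standard Borel space, that
take all combinations of values on every countable set of indices. -/
lemma exists_independent_family :
    ∃ E : ℝ → (ℕ → ℝ × (ℕ → ℕ)) → ℕ → ℕ, (∀ r, Measurable (E r)) ∧
      ∀ (S : Set ℝ), S.Countable → ∀ s : ℝ → ℕ → ℕ, ∃ p, ∀ r ∈ S, E r p = s r := by
  classical
  -- `p` is read as a list of pairs (index, value), and `E r p` is the value at the first occurrence
  -- of `r`. The second alternative makes the search total, with default position `0`.
  have hex : ∀ (r : ℝ) (p : ℕ → ℝ × (ℕ → ℕ)), ∃ n, (p n).1 = r ∨ ∀ m, (p m).1 ≠ r := by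
    intro r p
    by_cases h : ∃ n, (p n).1 = r
    · exact h.imp fun n hn => Or.inl hn
    · exact ⟨0, Or.inr (by simpa using h)⟩
  refine ⟨fun r p => (p (Nat.find (hex r p))).2, fun r => ?_, fun S hS s => ?_⟩
  · have hm : ∀ n, Measurable fun p : ℕ → ℝ × (ℕ → ℕ) => (p n).1 :=
      fun n => measurable_fst.comp (measurable_pi_apply n)
    refine Measurable.find (f := fun n (p : ℕ → ℝ × (ℕ → ℕ)) => (p n).2)
      (fun n => measurable_snd.comp (measurable_pi_apply n)) (fun n => ?_) (hex r)
    have h1 : ∀ n, MeasurableSet {p : ℕ → ℝ × (ℕ → ℕ) | (p n).1 = r} :=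
      fun n => measurableSet_eq_fun (hm n) measurable_const
    have h2 : MeasurableSet {p : ℕ → ℝ × (ℕ → ℕ) | ∀ m, (p m).1 ≠ r} := by
      rw [Set.ofPred_forall]
      exact MeasurableSet.iInter fun m => (h1 m).compl
    exact (h1 n).union h2
  · rcases S.eq_empty_or_nonempty with rfl | hne
    · exact ⟨fun _ => (0, fun _ => 0), by simp⟩
    obtain ⟨e, rfl⟩ := hS.exists_eq_range hne
    -- Repetitions in `e` are harmless: the listed value depends only on `e n`.
    refine ⟨fun n => (e n, s (e n)), ?_⟩
    rintro _ ⟨n, rfl⟩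
    rcases Nat.find_spec (hex (e n) fun n => (e n, s (e n))) with h | h
    · have h' : e (Nat.find (hex (e n) fun n => (e n, s (e n)))) = e n := h
      exact congrArg s h'
    · exact absurd rfl (h n)

end IndependentFamily

/-! ### Gluing actions along a Borel partition -/

section Gluing

lemma measurableEmbedding_sumElim {A B X : Type*} [MeasurableSpace A] [MeasurableSpace B]
    [MeasurableSpace X] {u : A → X} {v : B → X} (hu : MeasurableEmbedding u)
    (hv : MeasurableEmbedding v) (h : Disjoint (Set.range u) (Set.range v)) :
    MeasurableEmbedding (Sum.elim u v) where
  injective := hu.injective.sumElim hv.injective fun a b hab =>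
    Set.disjoint_left.1 h ⟨a, rfl⟩ ⟨b, hab.symm⟩
  measurable := hu.measurable.sumElim hv.measurable
  measurableSet_image' := by
    intro S hS
    have : Sum.elim u v '' S = u '' (Sum.inl ⁻¹' S) ∪ v '' (Sum.inr ⁻¹' S) := by
      ext x
      simp
    rw [this]
    exact (hu.measurableSet_image.2 (measurable_inl hS)).union
      (hv.measurableSet_image.2 (measurable_inr hS))

/-- Borel actions on three pieces that partition `X` glue to a Borel action on `X`. -/
lemma exists_glued_action {K A B C X : Type*} [Group K] [MeasurableSpace A] [MeasurableSpace B]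
    [MeasurableSpace C] [MeasurableSpace X] (a : K →* Equiv.Perm A) (b : K →* Equiv.Perm B)
    (c : K →* Equiv.Perm C) (ha : ∀ k, Measurable (a k)) (hb : ∀ k, Measurable (b k))
    (hc : ∀ k, Measurable (c k)) {u : A → X} {v : B → X} {w : C → X}
    (hu : MeasurableEmbedding u) (hv : MeasurableEmbedding v) (hw : MeasurableEmbedding w)
    (huv : Disjoint (Set.range u) (Set.range v))
    (hrange : Set.range w = (Set.range u ∪ Set.range v)ᶜ) :
    ∃ σ : K →* Equiv.Perm X, (∀ k, Measurable (σ k)) ∧ (∀ k x, σ k (u x) = u (a k x)) ∧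
      (∀ k x, σ k (v x) = v (b k x)) ∧ ∀ k x, σ k (w x) = w (c k x) := by
  have hvw : Disjoint (Set.range v) (Set.range w) := by
    rw [hrange]
    exact (disjoint_compl_right).mono_left Set.subset_union_right
  have hj : MeasurableEmbedding (Sum.elim u (Sum.elim v w)) := by
    refine measurableEmbedding_sumElim hu (measurableEmbedding_sumElim hv hw hvw) ?_
    rw [Set.Sum.elim_range, Set.disjoint_union_right, hrange]
    exact ⟨huv, (disjoint_compl_right).mono_left Set.subset_union_left⟩
  have hsurj : Function.Surjective (Sum.elim u (Sum.elim v w)) := by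
    rw [← Set.range_eq_univ, Set.Sum.elim_range, Set.Sum.elim_range, hrange, ← Set.union_assoc,
      Set.union_compl_self]
  let e := Equiv.ofBijective _ ⟨hj.injective, hsurj⟩
  let S : K →* Equiv.Perm (A ⊕ (B ⊕ C)) := (Equiv.Perm.sumCongrHom _ _).comp
    (a.prod ((Equiv.Perm.sumCongrHom _ _).comp (b.prod c)))
  let σ : K →* Equiv.Perm X := e.permCongrHom.toMonoidHom.comp S
  have key : ∀ k s, σ k (e s) = e (S k s) := by
    intro k s
    show e (S k (e.symm (e s))) = e (S k s)
    rw [e.symm_apply_apply]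
  have hSm : ∀ k, Measurable (S k) := fun k => (ha k).sumMap ((hb k).sumMap (hc k))
  refine ⟨σ, fun k s hs => ?_, fun k x => key k (Sum.inl x),
    fun k x => key k (Sum.inr (Sum.inl x)), fun k x => key k (Sum.inr (Sum.inr x))⟩
  have : σ k ⁻¹' s = e '' (S k ⁻¹' (e ⁻¹' s)) := by
    ext x
    obtain ⟨y, rfl⟩ := e.surjective x
    simp [key]
  rw [this]
  exact hj.measurableSet_image.2 (hSm k (hj.measurable hs))

/-- The homomorphism into the permutations given by an action. -/
def permHomOfAction {M A : Type*} [Group M] (a : M → A → A) (h1 : ∀ x, a 1 x = x)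
    (hmul : ∀ g h x, a (g * h) x = a g (a h x)) : M →* Equiv.Perm A :=
  letI : MulAction M A := { smul := a, one_smul := h1, mul_smul := hmul }
  MulAction.toPermHom M A

@[simp] lemma permHomOfAction_apply {M A : Type*} [Group M] (a : M → A → A) (h1 : ∀ x, a 1 x = x)
    (hmul : ∀ g h x, a (g * h) x = a g (a h x)) (g : M) (x : A) :
    permHomOfAction a h1 hmul g x = a g x := rfl

end Gluing

/-! ### Representatives of almost everywhere classes -/

section Basics

variable {X : Type*} [MeasurableSpace X] {μ : Measure X}

lemma toAut_eq_iff [StandardBorelSpace X] {φ ψ : Gmp μ} : toAut μ φ = toAut μ ψ ↔ ∀ᵐ x ∂μ, φ.1 x = ψ.1 x := by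
  have h : toAut μ φ = toAut μ ψ ↔ ∀ᵐ x ∂μ, φ.1.symm (ψ.1 x) = x := QuotientGroup.eq
  rw [h]
  refine Filter.eventually_congr (Filter.Eventually.of_forall fun x => ?_)
  rw [Equiv.symm_apply_eq, eq_comm]

/-- A countable group of measure preserving maps that is an action almost everywhere is an action
on an invariant conull Borel set. -/
lemma exists_invariant_conull {K : Type*} [Group K] [Countable K] (ψ : K → X → X)
    (hψ : ∀ k, MeasurePreserving (ψ k) μ μ) (h1 : ∀ᵐ x ∂μ, ψ 1 x = x)
    (hmul : ∀ k l, ∀ᵐ x ∂μ, ψ (k * l) x = ψ k (ψ l x)) {Z : Set X} (hZ : ∀ᵐ x ∂μ, x ∈ Z) :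
    ∃ Y : Set X, MeasurableSet Y ∧ (∀ᵐ x ∂μ, x ∈ Y) ∧ Y ⊆ Z ∧ (∀ x ∈ Y, ψ 1 x = x) ∧
      (∀ k l, ∀ x ∈ Y, ψ (k * l) x = ψ k (ψ l x)) ∧ ∀ k, ∀ x ∈ Y, ψ k x ∈ Y := by
  have hall : ∀ᵐ x ∂μ, x ∈ Z ∧ ψ 1 x = x ∧ ∀ k l, ψ (k * l) x = ψ k (ψ l x) := by
    filter_upwards [hZ, h1, ae_all_iff.2 fun k => ae_all_iff.2 (hmul k)] with x a b c
    exact ⟨a, b, c⟩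
  obtain ⟨W, hW, hWm, hWp⟩ := hall.exists_measurable_mem
  -- The points of `W` whose images under all `ψ k` stay in `W`.
  refine ⟨W ∩ ⋂ k, ψ k ⁻¹' W, ?_, ?_, ?_, ?_, ?_, ?_⟩
  · exact hWm.inter (MeasurableSet.iInter fun k => (hψ k).measurable hWm)
  · have hk : ∀ k, ∀ᵐ x ∂μ, ψ k x ∈ W := fun k => (hψ k).quasiMeasurePreserving.ae hW
    filter_upwards [hW, ae_all_iff.2 hk] with x a b
    exact ⟨a, Set.mem_iInter.2 b⟩
  · exact fun x hx => (hWp x hx.1).1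
  · exact fun x hx => (hWp x hx.1).2.1
  · exact fun k l x hx => (hWp x hx.1).2.2 k l
  · intro l x hx
    have hx2 := Set.mem_iInter.1 hx.2
    refine ⟨hx2 l, Set.mem_iInter.2 fun k => ?_⟩
    show ψ k (ψ l x) ∈ W
    rw [← (hWp x hx.1).2.2 k l]
    exact hx2 (k * l)

lemma mem_Gmp_of_ae_eq [StandardBorelSpace X] {σ : Equiv.Perm X} (hσ : Measurable σ) {φ : X → X}
    (hφ : MeasurePreserving φ μ μ) (h : ∀ᵐ x ∂μ, σ x = φ x) : σ ∈ Gmp μ :=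
  show MeasurePreserving σ μ μ from ⟨hσ, (Measure.map_congr h).trans hφ.map_eq⟩

end Basics

/-! ### The canonical action over the parameters -/

section FibreAction

/-- The standard Borel space on which the families of maps `ℕ → ℕ` are parametrized. -/
abbrev Param : Type := ℕ → ℝ × (ℕ → ℕ)

/-- The action on sequences of reals over a parameter, by permutation of the coordinates. -/
def fibreMap {G : Type*} (E : G → Param → ℕ → ℕ) (g : G) (z : Param × (ℕ → ℝ)) :
    Param × (ℕ → ℝ) :=
  (z.1, fun n => z.2 (E g z.1 n))

lemma measurable_fibreMap {G : Type*} {E : G → Param → ℕ → ℕ} (hE : ∀ g, Measurable (E g)) (g : G) :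
    Measurable (fibreMap E g) := by
  refine measurable_fst.prodMk (measurable_pi_lambda _ fun n => ?_)
  have h2 : Measurable fun q : ℕ × (ℕ → ℝ) => q.2 q.1 :=
    measurable_from_prod_countable_right fun n => measurable_pi_apply n
  exact h2.comp ((((measurable_pi_apply n).comp (hE g)).comp measurable_fst).prodMk measurable_snd)

variable {G : Type*} [Group G]

/-- The parameters at which a family of maps is a right action of the subgroup `H` on `ℕ`. -/
def actionLocus (E : G → Param → ℕ → ℕ) (H : Subgroup G) : Set Param :=
  -- Precomposition reverses order, so a right action on `ℕ` yields a left action on sequences.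
  {p | (∀ n, E 1 p n = n) ∧ ∀ g ∈ H, ∀ h ∈ H, ∀ n, E (g * h) p n = E h p (E g p n)}

lemma actionLocus_anti (E : G → Param → ℕ → ℕ) {H K : Subgroup G} (h : H ≤ K) :
    actionLocus E K ⊆ actionLocus E H :=
  fun _ hp => ⟨hp.1, fun a ha b hb => hp.2 a (h ha) b (h hb)⟩

lemma measurableSet_actionLocus {E : G → Param → ℕ → ℕ} (hE : ∀ g, Measurable (E g))
    (H : Subgroup G) [Countable H] : MeasurableSet (actionLocus E H) := by
  have hEn : ∀ g n, Measurable fun p => E g p n :=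
    fun g n => (measurable_pi_apply n).comp (hE g)
  have : actionLocus E H = (⋂ n, {p | E 1 p n = n}) ∩ ⋂ (g : H) (h : H) (n : ℕ),
      {p | E (g * h : G) p n = E h p (E g p n)} := by
    ext p
    simp [actionLocus]
  rw [this]
  refine (MeasurableSet.iInter fun n => measurableSet_eq_fun (hEn 1 n) measurable_const).inter
    (MeasurableSet.iInter fun g => MeasurableSet.iInter fun h => MeasurableSet.iInter fun n =>
      measurableSet_eq_fun (hEn _ n) ?_)
  have h2 : Measurable fun q : ℕ × (ℕ → ℕ) => q.2 q.1 :=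
    measurable_from_prod_countable_right fun n => measurable_pi_apply n
  exact h2.comp ((hEn g n).prodMk (hE h))

/-- Given a countable subgroup `H` and `a ∉ H` there is a parameter at which `H` acts by countably
many copies of its regular action but no subgroup that contains `a` acts. -/
lemma exists_regular_param {E : G → Param → ℕ → ℕ}
    (hE : ∀ (S : Set G), S.Countable → ∀ s : G → ℕ → ℕ, ∃ p, ∀ g ∈ S, E g p = s g)
    (H : Subgroup G) [Countable H] {a : G} (ha : a ∉ H) :
    ∃ (p : Param) (b : H × ℕ ≃ ℕ), p ∈ actionLocus E H ∧
      (∀ K : Subgroup G, a ∈ K → p ∉ actionLocus E K) ∧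
      ∀ (h k : H) (n : ℕ), E h p (b (k, n)) = b (k * h, n) := by
  classical
  obtain ⟨b⟩ : Nonempty (H × ℕ ≃ ℕ) := nonempty_equiv_of_countable
  -- `H` acts by right translation on `H × ℕ`, the factor `ℕ` making the set infinite even for
  -- finite `H`. The element `a` gets the constant map `0`, which no group action allows.
  obtain ⟨p, hp⟩ := hE (insert a H) ((Set.to_countable (H : Set G)).insert a)
    (fun g m => if hg : g ∈ H then b ((b.symm m).1 * ⟨g, hg⟩, (b.symm m).2) else 0)
  have hpH : ∀ (h k : H) (n : ℕ), E h p (b (k, n)) = b (k * h, n) := by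
    intro h k n
    rw [hp h (Set.mem_insert_of_mem _ h.2)]
    simp
  have hpa : ∀ n, E a p n = 0 := by
    intro n
    rw [hp a (Set.mem_insert _ _)]
    simp [ha]
  refine ⟨p, b, ⟨fun n => ?_, fun g hg h hh n => ?_⟩, fun K haK hK => ?_, hpH⟩
  · obtain ⟨⟨k, m⟩, rfl⟩ := b.surjective n
    simpa using hpH 1 k m
  · obtain ⟨⟨k, m⟩, rfl⟩ := b.surjective n
    have h1 := hpH ⟨g, hg⟩ k m
    have h2 := hpH ⟨h, hh⟩ (k * ⟨g, hg⟩) m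
    have h3 := hpH (⟨g, hg⟩ * ⟨h, hh⟩) k m
    simp only [Subgroup.coe_mul] at h1 h2 h3
    rw [h1, h2, h3, mul_assoc]
  · have key : ∀ n, E a⁻¹ p 0 = n := by
      intro n
      have := hK.2 a haK a⁻¹ (K.inv_mem haK) n
      rw [mul_inv_cancel, hK.1, hpa] at this
      exact this.symm
    exact zero_ne_one ((key 0).symm.trans (key 1))

end FibreAction

/-! ### Extending a lift to a larger countable subgroup -/

section Extension

variable {G : Type*} [Group G] {X : Type*} [MeasurableSpace X] [StandardBorelSpace X]

/-- A lift to a countable subgroup `H` that is canonical over the action locus of `H` extends to a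
lift to any countable `K > H` that is canonical over the action locus of `K`. -/
lemma exists_extension {μ : Measure X} (f : G →* Aut μ)
    {E : G → Param → ℕ → ℕ} (hEm : ∀ g, Measurable (E g))
    (hE : ∀ (S : Set G), S.Countable → ∀ s : G → ℕ → ℕ, ∃ p, ∀ g ∈ S, E g p = s g)
    {ι : Param × (ℕ → ℝ) → X} (hι : MeasurableEmbedding ι) (hnull : μ (Set.range ι) = 0)
    {H K : Subgroup G} (hHK : H ≤ K) [Countable H] [Countable K] {a : G} (haK : a ∈ K)
    (haH : a ∉ H) (ρ : H →* Gmp μ) (hρ : ∀ h, toAut μ (ρ h) = f h)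
    (hcan : ∀ (h : H) (z : Param × (ℕ → ℝ)), z.1 ∈ actionLocus E H →
      (ρ h).1 (ι z) = ι (fibreMap E h z)) :
    ∃ σ : K →* Gmp μ, (∀ k, toAut μ (σ k) = f k) ∧
      (∀ h : H, σ (Subgroup.inclusion hHK h) = ρ h) ∧
      ∀ (k : K) (z : Param × (ℕ → ℝ)), z.1 ∈ actionLocus E K →
        (σ k).1 (ι z) = ι (fibreMap E k z) := by
  choose φ hφ using fun k : K => QuotientGroup.mk'_surjective (Imp μ) (f k)
  have hφmul : ∀ k l, ∀ᵐ x ∂μ, (φ (k * l)).1 x = (φ k).1 ((φ l).1 x) := by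
    intro k l
    have h : toAut μ (φ (k * l)) = toAut μ (φ k * φ l) := by
      rw [map_mul, hφ, hφ, hφ, Subgroup.coe_mul, map_mul]
    exact toAut_eq_iff.1 h
  have hφone : ∀ᵐ x ∂μ, (φ 1).1 x = x := by
    have h : toAut μ (φ 1) = toAut μ 1 := by
      rw [hφ, Subgroup.coe_one, map_one, map_one]
    exact toAut_eq_iff.1 h
  have hφρ : ∀ h : H, ∀ᵐ x ∂μ, (φ (Subgroup.inclusion hHK h)).1 x = (ρ h).1 x := by
    intro h
    refine toAut_eq_iff.1 ?_
    rw [hφ, hρ, Subgroup.coe_inclusion]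
  have hρm : ∀ h : H, Measurable (ρ h).1 := fun h => MeasurePreserving.measurable (ρ h).2
  -- `Y` avoids the reserve `Set.range ι`, and on it the representatives for `H` agree exactly with
  -- `ρ`.
  obtain ⟨Y, hYm, hYae, hYsub, hY1, hYmul, hYinv⟩ := exists_invariant_conull (μ := μ)
    (fun k => (φ k).1) (fun k => (φ k).2) hφone hφmul
    (Z := {x | x ∉ Set.range ι ∧ ∀ h : H, (φ (Subgroup.inclusion hHK h)).1 x = (ρ h).1 x}) (by
      filter_upwards [measure_eq_zero_iff_ae_notMem.1 hnull, ae_all_iff.2 hφρ] with x h1 h2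
      exact ⟨h1, h2⟩)
  -- the conull piece
  let a₁ : K →* Equiv.Perm Y := permHomOfAction (fun k y => ⟨(φ k).1 y.1, hYinv k _ y.2⟩)
    (fun y => Subtype.ext (hY1 y.1 y.2)) (fun k l y => Subtype.ext (hYmul k l y.1 y.2))
  have ha₁ : ∀ k, Measurable (a₁ k) := fun k =>
    ((MeasurePreserving.measurable (φ k).2).comp measurable_subtype_coe).subtype_mk
  have hYρ : ∀ (h : H) x, x ∈ Y → (ρ h).1 x ∈ Y := by
    intro h x hx
    rw [← (hYsub hx).2 h]
    exact hYinv _ x hx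
  -- the canonical piece
  let D : Set (Param × (ℕ → ℝ)) := Prod.fst ⁻¹' actionLocus E K
  have hDm : MeasurableSet D := measurable_fst (measurableSet_actionLocus hEm K)
  let a₂ : K →* Equiv.Perm D := permHomOfAction (fun k z => ⟨fibreMap E k z.1, z.2⟩)
    (by
      rintro ⟨⟨p, x⟩, hp⟩
      have hp' : p ∈ actionLocus E K := hp
      simp [fibreMap, hp'.1])
    (by
      rintro k l ⟨⟨p, x⟩, hp⟩
      have hp' : p ∈ actionLocus E K := hp
      simp [fibreMap, hp'.2 k k.2 l l.2])
  have ha₂ : ∀ k, Measurable (a₂ k) := fun k =>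
    ((measurable_fibreMap hEm k).comp measurable_subtype_coe).subtype_mk
  have hv : MeasurableEmbedding fun z : D => ι z.1 := hι.comp (MeasurableEmbedding.subtype_coe hDm)
  have hYD : Disjoint (Set.range ((↑) : Y → X)) (Set.range fun z : D => ι z.1) := by
    rw [Set.disjoint_left]
    rintro _ ⟨y, rfl⟩ ⟨z, hz⟩
    exact (hYsub y.2).1 ⟨z.1, hz⟩
  have hDρ : ∀ (h : H) (z : D), (ρ h).1 (ι z.1) = ι (a₂ (Subgroup.inclusion hHK h) z).1 :=
    fun h z => hcan h z.1 (actionLocus_anti E hHK z.2)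
  -- the absorbing piece
  let N : Set X := (Set.range ((↑) : Y → X) ∪ Set.range fun z : D => ι z.1)ᶜ
  have hNm : MeasurableSet N :=
    ((MeasurableEmbedding.subtype_coe hYm).measurableSet_range.union hv.measurableSet_range).compl
  have hNρ : ∀ (h : H) x, x ∈ N → (ρ h).1 x ∈ N := by
    intro h x hx hx'
    have hback : (ρ h⁻¹).1 ((ρ h).1 x) = x := by
      show (ρ h⁻¹ * ρ h).1 x = x
      rw [← map_mul, inv_mul_cancel, map_one]
      rfl
    rcases hx' with ⟨y, hy⟩ | ⟨z, hz⟩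
    · refine hx (Or.inl ⟨⟨x, ?_⟩, rfl⟩)
      rw [← hback, ← hy]
      exact hYρ _ _ y.2
    · refine hx (Or.inr ⟨a₂ (Subgroup.inclusion hHK h⁻¹) z, ?_⟩)
      show ι (a₂ (Subgroup.inclusion hHK h⁻¹) z).1 = x
      rw [← hback, ← hz]
      exact (hDρ _ z).symm
  have : StandardBorelSpace N := hNm.standardBorel
  let r : H →* Equiv.Perm N := permHomOfAction (fun h x => ⟨(ρ h).1 x.1, hNρ h _ x.2⟩)
    (fun x => Subtype.ext (by simp)) (fun g h x => Subtype.ext (by simp))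
  have hr : ∀ h, Measurable (r h) := fun h =>
    ((hρm h).comp measurable_subtype_coe).subtype_mk
  -- The fibre over `p` lies in `N`, as `p` is outside the locus of `K`; since `p` is in the locus
  -- of `H`, `ρ` acts there by permuting coordinates.
  obtain ⟨p, b, hpH, hpK, hpb⟩ := exists_regular_param hE H haH
  have hwN : ∀ x : ℕ → ℝ, ι (p, x) ∈ N := by
    rintro x (⟨y, hy⟩ | ⟨z, hz⟩)
    · exact (hYsub y.2).1 ⟨_, hy.symm⟩
    · have h1 : z.1 = (p, x) := hι.injective hz
      have h2 : z.1.1 ∈ actionLocus E K := z.2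
      rw [h1] at h2
      exact hpK K haK h2
  -- Repeating each coordinate over all copies of `H` embeds the shift in this fibre.
  let w : (H → ℝ) → N := fun x => ⟨ι (p, fun n => x (b.symm n).1), hwN _⟩
  have hw : Measurable w := by
    refine (hι.measurable.comp (measurable_const.prodMk
      (measurable_pi_lambda _ fun n => ?_))).subtype_mk
    exact measurable_pi_apply _
  have hwi : Function.Injective w := by
    intro x y hxy
    have h1 := hι.injective (congrArg Subtype.val hxy)
    funext h
    simpa using congrFun (Prod.ext_iff.1 h1).2 (b (h, 0))
  have hwa : ∀ g x, w (shift H g x) = r g (w x) := by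
    intro g x
    refine Subtype.ext ?_
    show ι (p, _) = (ρ g).1 (ι (p, _))
    rw [hcan g _ hpH]
    refine congrArg ι (Prod.ext rfl (funext fun n => ?_))
    obtain ⟨⟨k, m⟩, rfl⟩ := b.surjective n
    simp [fibreMap, hpb]
  obtain ⟨e, he, hesurj, hea⟩ := exists_measurableEquiv_shift (Subgroup.inclusion hHK)
    (Subgroup.inclusion_injective hHK) r hr hw hwi hwa
  -- gluing
  obtain ⟨σ, hσm, hσ₁, hσ₂, hσ₃⟩ := exists_glued_action a₁ a₂ (shift K) ha₁ ha₂ measurable_shift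
    (MeasurableEmbedding.subtype_coe hYm) hv ((MeasurableEmbedding.subtype_coe hNm).comp he) hYD
    (by rw [hesurj.range_comp, Subtype.range_coe])
  have hσφ : ∀ k, ∀ᵐ x ∂μ, σ k x = (φ k).1 x := by
    intro k
    filter_upwards [hYae] with x hx
    exact hσ₁ k ⟨x, hx⟩
  let τ : K →* Gmp μ := σ.codRestrict (Gmp μ)
    fun k => mem_Gmp_of_ae_eq (hσm k) (φ k).2 (hσφ k)
  refine ⟨τ, fun k => ?_, fun h => ?_, fun k z hz => hσ₂ k ⟨z, hz⟩⟩
  · rw [← hφ]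
    exact toAut_eq_iff.2 (hσφ k)
  · refine Subtype.ext (Equiv.ext fun x => ?_)
    show σ (Subgroup.inclusion hHK h) x = (ρ h).1 x
    by_cases hx : x ∈ N
    · obtain ⟨y, hy⟩ := hesurj ⟨x, hx⟩
      have hy' : x = (e y).1 := by rw [hy]
      have h1 := hσ₃ (Subgroup.inclusion hHK h) y
      simp only [Function.comp_apply] at h1
      rw [hy', h1, hea]
      rfl
    · rcases not_not.1 hx with ⟨y, rfl⟩ | ⟨z, rfl⟩
      · rw [hσ₁]
        exact (hYsub y.2).2 h
      · rw [hσ₂]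
        exact (hDρ h z).symm

end Extension

universe u

/-! ### Transfinite construction by Zorn's lemma -/

section Zorn

/-- The closure is an image of the free group on `S`. -/
lemma countable_closure {G : Type*} [Group G] {S : Set G} (hS : S.Countable) :
    Countable (Subgroup.closure S) := by
  have : Countable S := hS
  rw [FreeGroup.closure_eq_range]
  exact (MonoidHom.rangeRestrict_surjective _).countable

/-- A subgroup of a product that is the graph of a partial map is the graph of a homomorphism. -/
lemma exists_hom_of_graph {G M : Type*} [Group G] [Group M] (Γ : Subgroup (G × M))
    (hΓ : ∀ q ∈ Γ, q.1 = 1 → q.2 = 1) :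
    ∃ ρ : Γ.map (MonoidHom.fst G M) →* M, ∀ h, (h.1, ρ h) ∈ Γ := by
  have hex : ∀ h : Γ.map (MonoidHom.fst G M), ∃ m, (h.1, m) ∈ Γ := by
    rintro ⟨_, ⟨⟨g, m⟩, hq, rfl⟩⟩
    exact ⟨m, hq⟩
  have huniq : ∀ g m n, (g, m) ∈ Γ → (g, n) ∈ Γ → m = n := by
    intro g m n hm hn
    have := hΓ _ (Γ.mul_mem hm (Γ.inv_mem hn)) (by simp)
    exact mul_inv_eq_one.1 this
  choose ρ hρ using hex
  exact ⟨MonoidHom.mk' ρ fun g h => huniq _ _ _ (hρ (g * h)) (Γ.mul_mem (hρ g) (hρ h)), hρ⟩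

variable {G : Type*} [Group G] {X : Type*} [MeasurableSpace X] [StandardBorelSpace X]

/-- A group ranked in a linear order with countable initial segments has lifts,
given an independent family of maps and a null embedding. -/
lemma exists_lift_of_null_embedding {μ : Measure X} (f : G →* Aut μ)
    {T : Type*} [LinearOrder T] (j : G → T) (hj : ∀ t, {g | j g ≤ t}.Countable)
    {E : G → Param → ℕ → ℕ} (hEm : ∀ g, Measurable (E g))
    (hE : ∀ (S : Set G), S.Countable → ∀ s : G → ℕ → ℕ, ∃ p, ∀ g ∈ S, E g p = s g)
    {ι : Param × (ℕ → ℝ) → X} (hι : MeasurableEmbedding ι) (hnull : μ (Set.range ι) = 0) :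
    ∃ h : G →* Gmp μ, (toAut μ).comp h = f := by
  let dom : Subgroup (G × Gmp μ) → Subgroup G := fun Γ => Γ.map (MonoidHom.fst G (Gmp μ))
  -- Partial lifts as graphs, so that chains are bounded by suprema of subgroups. The lower set `I`
  -- ensures that a proper domain is countable.
  let 𝓢 : Set (Subgroup (G × Gmp μ)) := {Γ | (∀ q ∈ Γ, toAut μ q.2 = f q.1) ∧
    (∀ q ∈ Γ, q.1 = 1 → q.2 = 1) ∧
    (∀ q ∈ Γ, ∀ z : Param × (ℕ → ℝ), z.1 ∈ actionLocus E (dom Γ) →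
      q.2.1 (ι z) = ι (fibreMap E q.1 z)) ∧
    ∃ I : Set T, IsLowerSet I ∧ dom Γ = Subgroup.closure (j ⁻¹' I)}
  have hdom : ∀ {Γ Γ'}, Γ ≤ Γ' → dom Γ ≤ dom Γ' := fun h => Subgroup.map_mono h
  have hbot : (⊥ : Subgroup (G × Gmp μ)) ∈ 𝓢 := by
    refine ⟨?_, ?_, ?_, ∅, isLowerSet_empty, ?_⟩
    · rintro q hq
      rw [Subgroup.mem_bot.1 hq, Prod.snd_one, Prod.fst_one, map_one, map_one]
    · rintro q hq -
      rw [Subgroup.mem_bot.1 hq, Prod.snd_one]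
    · rintro q hq ⟨p, x⟩ hz
      rw [Subgroup.mem_bot.1 hq]
      have hz' : ∀ n, E 1 p n = n := hz.1
      simp [fibreMap, hz']
    · simp [dom]
  obtain ⟨Γ, -, hmax⟩ := zorn_le_nonempty₀ 𝓢 (by
    intro c hc hchain y hy
    have hmem : ∀ {q}, q ∈ sSup c ↔ ∃ Γ ∈ c, q ∈ Γ :=
      Subgroup.mem_sSup_of_directedOn ⟨y, hy⟩ hchain.directedOn
    refine ⟨sSup c, ⟨?_, ?_, ?_, ?_⟩, fun z hz => le_sSup hz⟩
    · intro q hq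
      obtain ⟨Γ, hΓ, hq⟩ := hmem.1 hq
      exact (hc hΓ).1 q hq
    · intro q hq
      obtain ⟨Γ, hΓ, hq⟩ := hmem.1 hq
      exact (hc hΓ).2.1 q hq
    · intro q hq z hz
      obtain ⟨Γ, hΓ, hq⟩ := hmem.1 hq
      exact (hc hΓ).2.2.1 q hq z (actionLocus_anti E (hdom (le_sSup hΓ)) hz)
    · choose I hI using fun Γ : c => (hc Γ.2).2.2.2
      refine ⟨⋃ Γ, I Γ, isLowerSet_iUnion fun Γ => (hI Γ).1, ?_⟩
      rw [Set.preimage_iUnion, Subgroup.closure_iUnion]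
      simp only [dom, sSup_eq_iSup', Subgroup.map_iSup]
      exact iSup_congr fun Γ => (hI Γ).2) ⊥ hbot
  obtain ⟨⟨hlift, hfun, hcan, I, hI, hdomI⟩, hmax⟩ := hmax
  obtain ⟨ρ, hρ⟩ := exists_hom_of_graph Γ hfun
  have htop : dom Γ = ⊤ := by
    by_contra hne
    obtain ⟨a, ha⟩ : ∃ a, a ∉ dom Γ := by
      by_contra! h
      exact hne (eq_top_iff.2 fun g _ => h g)
    -- An element of `I` above `j a` would put `a` in the domain.
    have hIa : j ⁻¹' I ⊆ {g | j g ≤ j a} := by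
      intro g hg
      by_contra hlt
      refine ha ?_
      rw [hdomI]
      exact Subgroup.subset_closure (hI (le_of_lt (not_le.1 hlt)) hg)
    let K := Subgroup.closure {g | j g ≤ j a}
    have hHK : dom Γ ≤ K := by
      rw [hdomI]
      exact Subgroup.closure_mono hIa
    have : Countable K := countable_closure (hj (j a))
    have : Countable (dom Γ) := (Subgroup.inclusion_injective hHK).countable
    have haK : a ∈ K := Subgroup.subset_closure (le_refl (j a))
    obtain ⟨σ, hσf, hσρ, hσcan⟩ := exists_extension f hEm hE hι hnull hHK haK ha ρ
      (fun h => hlift _ (hρ h)) (fun h => hcan _ (hρ h))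
    let Γ' : Subgroup (G × Gmp μ) := (K.subtype.prod σ).range
    have hΓ' : dom Γ' = K := by
      ext g
      constructor
      · rintro ⟨_, ⟨k, rfl⟩, rfl⟩
        exact k.2
      · intro hg
        exact ⟨_, ⟨⟨g, hg⟩, rfl⟩, rfl⟩
    have hle : Γ ≤ Γ' := by
      intro q hq
      have hq1 : q.1 ∈ dom Γ := ⟨q, hq, rfl⟩
      refine ⟨Subgroup.inclusion hHK ⟨q.1, hq1⟩, Prod.ext rfl ?_⟩
      show σ (Subgroup.inclusion hHK ⟨q.1, hq1⟩) = q.2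
      rw [hσρ]
      have := hfun _ (Γ.mul_mem (hρ ⟨q.1, hq1⟩) (Γ.inv_mem hq)) (by simp)
      exact mul_inv_eq_one.1 this
    have hmem : Γ' ∈ 𝓢 := by
      refine ⟨?_, ?_, ?_, Set.Iic (j a), isLowerSet_Iic _, hΓ'⟩
      · rintro _ ⟨k, rfl⟩
        exact hσf k
      · rintro _ ⟨k, rfl⟩ hk
        have hk' : k = 1 := Subtype.ext hk
        rw [hk', map_one]
        rfl
      · rintro _ ⟨k, rfl⟩ z hz
        rw [hΓ'] at hz
        exact hσcan k z hz
    refine ha (hdom (hmax hmem hle) ?_)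
    rw [hΓ']
    exact haK
  refine ⟨ρ.comp ((MonoidHom.id G).codRestrict _ fun g => ?_), ?_⟩
  · show g ∈ dom Γ
    rw [htop]
    trivial
  · ext1 g
    exact hlift _ (hρ _)

end Zorn

/-! ### Countable spaces, cardinality `ℵ₁`, and CH -/

section Cases

variable {X : Type*} [MeasurableSpace X] [StandardBorelSpace X]

lemma exists_null_embedding (μ : Measure X) [IsProbabilityMeasure μ] (hX : ¬ Countable X)
    {Z : Type*} [MeasurableSpace Z] [StandardBorelSpace Z] [Nonempty Z] :
    ∃ ι : Z → X, MeasurableEmbedding ι ∧ μ (Set.range ι) = 0 := by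
  have hRZ : ¬ Countable (ℝ × Z) := fun h =>
    Cardinal.not_countable_real (Set.countable_univ_iff.2
      (Prod.mk_left_injective (Classical.arbitrary Z)).countable)
  -- This cuts `X` into uncountably many disjoint copies of `Z`, only countably many of positive
  -- measure.
  let e : ℝ × Z ≃ᵐ X := PolishSpace.measurableEquivOfNotCountable hRZ hX
  have hemb : ∀ r : ℝ, MeasurableEmbedding fun z : Z => e (r, z) := fun r =>
    e.measurableEmbedding.comp (measurableEmbedding_prodMk_left r)
  have hdisj : Pairwise (Function.onFun Disjoint fun r : ℝ => Set.range fun z : Z => e (r, z)) := by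
    intro r s hrs
    refine Set.disjoint_left.2 ?_
    rintro _ ⟨z, rfl⟩ ⟨y, hy⟩
    exact hrs (congrArg Prod.fst (e.injective hy)).symm
  have hc := Measure.countable_meas_pos_of_disjoint_iUnion (μ := μ)
    (fun r => (hemb r).measurableSet_range) hdisj
  obtain ⟨r, hr⟩ : ∃ r : ℝ, μ (Set.range fun z : Z => e (r, z)) = 0 := by
    by_contra! h
    refine Cardinal.not_countable_real (hc.mono fun r _ => ?_)
    exact pos_iff_ne_zero.2 (h r)
  exact ⟨_, hemb r, hr⟩

/-- On a countable space the canonical map onto the automorphism group splits. -/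
lemma exists_section_of_countable (μ : Measure X) [Countable X] :
    ∃ s : Aut μ →* Gmp μ, (toAut μ).comp s = MonoidHom.id _ := by
  classical
  let S : Set X := {x | μ {x} ≠ 0}
  have hS : ∀ᵐ x ∂μ, x ∈ S := by
    rw [ae_iff, ← Set.biUnion_of_singleton {x | x ∉ S}]
    refine (measure_biUnion_null_iff (Set.to_countable _)).2 fun x hx => ?_
    exact not_not.1 hx
  have hφ : ∀ (φ : Gmp μ) x, φ.1 x ∈ S ↔ x ∈ S := by
    intro φ x
    have h1 : μ (φ.1 ⁻¹' {φ.1 x}) = μ {φ.1 x} :=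
      MeasurePreserving.measure_preimage φ.2 (measurableSet_singleton _).nullMeasurableSet
    have h2 : φ.1 ⁻¹' {φ.1 x} = {x} := by
      ext y
      simp
    rw [h2] at h1
    simp only [S, Set.mem_ofPred_eq, h1]
  -- Almost everywhere equal maps agree at every atom, so this depends only on the class of `φ`.
  let t : Gmp μ →* Equiv.Perm X := permHomOfAction (fun φ x => if x ∈ S then φ.1 x else x)
    (fun x => by simp) (fun φ ψ x => by
      by_cases hx : x ∈ S
      · simp [hx, hφ]
      · simp [hx])
  have ht : ∀ φ x, x ∈ S → t φ x = φ.1 x := fun φ x hx => if_pos hx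
  let t' : Gmp μ →* Gmp μ := t.codRestrict (Gmp μ) fun φ =>
    mem_Gmp_of_ae_eq (measurable_of_countable _) φ.2 (by filter_upwards [hS] with x hx using ht φ x hx)
  refine ⟨QuotientGroup.lift (Imp μ) t' ?_, ?_⟩
  · intro φ hφI
    have hφI' : ∀ᵐ x ∂μ, φ.1 x = x := hφI
    refine Subtype.ext (Equiv.ext fun x => ?_)
    show (if x ∈ S then φ.1 x else x) = x
    split_ifs with hx
    · by_contra hne
      exact hx (measure_mono_null (Set.singleton_subset_iff.2 hne) (ae_iff.1 hφI'))
    · rfl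
  · refine MonoidHom.ext fun q => ?_
    obtain ⟨φ, rfl⟩ := QuotientGroup.mk'_surjective (Imp μ) q
    exact toAut_eq_iff.2 (by filter_upwards [hS] with x hx using ht φ x hx)

/-- Every homomorphism to `Aut μ` of a group of cardinality at most `ℵ₁` lifts. -/
theorem exists_lift_of_card_le {G : Type*} [Group G] (μ : Measure X) [IsProbabilityMeasure μ]
    (hG : Cardinal.mk G ≤ Cardinal.aleph 1) (f : G →* Aut μ) :
    ∃ h : G →* Gmp μ, (toAut μ).comp h = f := by
  by_cases hX : Countable X
  · obtain ⟨s, hs⟩ := exists_section_of_countable μ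
    exact ⟨s.comp f, by rw [← MonoidHom.comp_assoc, hs, MonoidHom.id_comp]⟩
  obtain ⟨ι, hι, hnull⟩ := exists_null_embedding μ hX (Z := Param × (ℕ → ℝ))
  obtain ⟨E, hEm, hE⟩ := exists_independent_family
  -- The bound on `G` is used twice: `ℵ₁ ≤ 𝔠` indexes the independent family by `G`, and `j` ranks
  -- `G` with countable initial segments.
  obtain ⟨⟨r, hr⟩⟩ : Nonempty (G ↪ ℝ) := by
    rw [← Cardinal.lift_mk_le', Cardinal.mk_real, Cardinal.lift_continuum]
    exact (Cardinal.lift_le.2 (hG.trans Cardinal.aleph_one_le_continuum)).trans_eq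
      Cardinal.lift_continuum
  obtain ⟨⟨j, hj⟩⟩ : Nonempty (G ↪ (Cardinal.aleph 1).ord.ToType) := by
    rwa [← Cardinal.le_def, Cardinal.mk_ord_toType]
  refine exists_lift_of_null_embedding f j (fun t => ?_) (E := fun g => E (r g))
    (fun g => hEm (r g)) (fun S hS s => ?_) hι hnull
  · have h1 : (Set.Iio t).Countable := by
      rw [← Cardinal.le_aleph0_iff_set_countable, ← Order.lt_succ_iff, ← Cardinal.aleph_zero,
        Cardinal.succ_aleph, zero_add]
      exact (Cardinal.mk_Iio_lt t (by simp)).trans_eq (Cardinal.mk_ord_toType _)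
    have h2 : (Set.Iic t).Countable := by
      rw [← Set.Iio_insert]
      exact h1.insert t
    exact h2.preimage_of_injOn hj.injOn
  · obtain ⟨p, hp⟩ := hE (r '' S) (hS.image r) (s ∘ Function.invFun r)
    refine ⟨p, fun g hg => ?_⟩
    rw [hp _ ⟨g, hg, rfl⟩, Function.comp_apply, Function.leftInverse_invFun hr]

/-- A Borel map is determined by the preimages of a countable separating family, and there are at
most continuum many Borel sets. -/
lemma mk_Aut_le_continuum (μ : Measure X) : Cardinal.mk (Aut μ) ≤ Cardinal.continuum := by
  refine Cardinal.mk_quotient_le.trans ?_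
  have hB : Cardinal.mk {t : Set X | MeasurableSet t} ≤ Cardinal.continuum := by
    have h := MeasurableSpace.cardinal_measurableSet_le_continuum
      (s := MeasurableSpace.countableGeneratingSet X)
      ((MeasurableSpace.countable_countableGeneratingSet).le_aleph0.trans
        Cardinal.aleph0_le_continuum)
    rwa [MeasurableSpace.generateFrom_countableGeneratingSet] at h
  let F : Gmp μ → ℕ → {t : Set X | MeasurableSet t} := fun φ n =>
    ⟨{x | MeasurableSpace.mapNatBool X (φ.1 x) n = true},
      (((measurable_pi_apply n).comp (MeasurableSpace.measurable_mapNatBool X)).comp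
        (MeasurePreserving.measurable φ.2)) (measurableSet_singleton true)⟩
  have hF : Function.Injective F := by
    intro φ ψ h
    refine Subtype.ext (Equiv.ext fun x => MeasurableSpace.injective_mapNatBool (α := X)
      (funext fun n => ?_))
    have h1 := Set.ext_iff.1 (congrArg Subtype.val (congrFun h n)) x
    exact Bool.eq_iff_iff.2 h1
  refine (Cardinal.mk_le_of_injective hF).trans ?_
  rw [Cardinal.mk_arrow, Cardinal.lift_id', Cardinal.mk_nat, Cardinal.lift_aleph0,
    ← Cardinal.continuum_power_aleph0]
  exact Cardinal.power_le_power_right hB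

/-- Under the continuum hypothesis every homomorphism to `Aut μ` lifts. -/
theorem exists_lift_of_continuum_eq {X : Type u} [MeasurableSpace X] [StandardBorelSpace X]
    {G : Type*} [Group G] (μ : Measure X) [IsProbabilityMeasure μ]
    (hCH : Cardinal.continuum.{0} = Cardinal.aleph.{0} 1) (f : G →* Aut μ) :
    ∃ h : G →* Gmp μ, (toAut μ).comp h = f := by
  -- It suffices to lift the inclusion of the range of `f`, whatever the size of `G`.
  have hcard : Cardinal.mk f.range ≤ Cardinal.aleph 1 := by
    refine (Cardinal.mk_subtype_le _).trans ((mk_Aut_le_continuum μ).trans_eq ?_)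
    rw [← Cardinal.lift_continuum.{u, 0}, hCH, Cardinal.lift_aleph, Ordinal.lift_one]
  obtain ⟨h, hh⟩ := exists_lift_of_card_le μ hcard f.range.subtype
  exact ⟨h.comp f.rangeRestrict, by
    rw [← MonoidHom.comp_assoc, hh, MonoidHom.subtype_comp_rangeRestrict]⟩

end Cases

/-! ### Near-actions versus homomorphisms to `Aut μ` -/

section NearActions

variable {G : Type*} [Group G] {X : Type*} [MeasurableSpace X] {μ : Measure X} {η : G → X → X}

lemma IsNearAction.ae_inv_apply (hη : IsNearAction μ η) (g : G) :
    ∀ᵐ x ∂μ, η g⁻¹ (η g x) = x := by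
  filter_upwards [hη.one_ae, hη.mul_ae g⁻¹ g] with x h1 h2
  rw [← h2, inv_mul_cancel, h1]

/-- The maps for `g` and `g⁻¹` are inverse almost everywhere, and images of null sets are null. This
turns the axioms on images into measurability and invariance for preimages. -/
lemma IsNearAction.preimage_ae_eq (hη : IsNearAction μ η) (g : G) {B : Set X} :
    η g ⁻¹' B =ᵐ[μ] η g⁻¹ '' B := by
  have hnull : ∀ S : Set X, μ S = 0 → μ (η g⁻¹ '' S) = 0 := by
    intro S hS
    refine measure_mono_null (Set.image_mono (subset_toMeasurable μ S)) ?_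
    rw [hη.measure_image _ _ (measurableSet_toMeasurable μ S), measure_toMeasurable, hS]
  have hinv := hη.ae_inv_apply g⁻¹
  rw [inv_inv] at hinv
  have h1 := measure_eq_zero_iff_ae_notMem.1 (hnull _ (ae_iff.1 hinv))
  filter_upwards [hη.ae_inv_apply g, h1] with x hx hx'
  refine propext ⟨fun h => ⟨η g x, h, hx⟩, ?_⟩
  rintro ⟨y, hy, rfl⟩
  have hy' : η g (η g⁻¹ y) = y := by
    by_contra h
    exact hx' ⟨y, h, rfl⟩
  show η g (η g⁻¹ y) ∈ B
  rwa [hy']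

lemma IsNearAction.exists_measurePreserving [StandardBorelSpace X] (hη : IsNearAction μ η)
    (g : G) : ∃ ψ : X → X, MeasurePreserving ψ μ μ ∧ ∀ᵐ x ∂μ, η g x = ψ x := by
  have hae : AEMeasurable (η g) μ := NullMeasurable.aemeasurable fun B hB =>
    (hη.nullMeasurableSet_image g⁻¹ B hB).congr (hη.preimage_ae_eq g).symm
  refine ⟨hae.mk, ⟨hae.measurable_mk, ?_⟩, hae.ae_eq_mk⟩
  rw [← Measure.map_congr hae.ae_eq_mk]
  ext B hB
  rw [Measure.map_apply_of_aemeasurable hae hB, measure_congr (hη.preimage_ae_eq g),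
    hη.measure_image _ _ hB]

/-- Each map of a measure preserving near-action is almost everywhere equal to a measure preserving
Borel bijection. -/
lemma IsNearAction.exists_Gmp [StandardBorelSpace X] (hη : IsNearAction μ η) (g : G) :
    ∃ φ : Gmp μ, ∀ᵐ x ∂μ, φ.1 x = η g x := by
  classical
  -- Treating all powers of `g` at once gives a conull set invariant under `g` and `g⁻¹`; there `g`
  -- acts bijectively, and the identity is used elsewhere.
  choose ψ hψ hψη using fun k : Subgroup.zpowers g => hη.exists_measurePreserving k
  have hone : ∀ᵐ x ∂μ, ψ 1 x = x := by
    filter_upwards [hη.one_ae, hψη 1] with x h1 h2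
    rw [← h2, Subgroup.coe_one, h1]
  have hmul : ∀ k l, ∀ᵐ x ∂μ, ψ (k * l) x = ψ k (ψ l x) := by
    intro k l
    filter_upwards [hη.mul_ae k l, hψη (k * l), hψη l,
      (hψ l).quasiMeasurePreserving.ae (hψη k)] with x h1 h2 h3 h4
    rw [← h4, ← h3, ← h1, ← h2, Subgroup.coe_mul]
  have : Countable (Subgroup.zpowers g) :=
    (Set.countable_range fun n : ℤ => g ^ n).to_subtype
  obtain ⟨Y, hYm, hYae, -, hY1, hYmul, hYinv⟩ :=
    exists_invariant_conull ψ hψ hone hmul (Z := Set.univ) (by simp)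
  let σ : Subgroup.zpowers g →* Equiv.Perm X :=
    permHomOfAction (fun k x => if x ∈ Y then ψ k x else x)
      (fun x => by
        split_ifs with h
        exacts [hY1 x h, rfl])
      (fun k l x => by
        by_cases h : x ∈ Y
        · simp only [h, if_true, hYinv l x h, hYmul k l x h]
        · simp only [h, if_false])
  let k : Subgroup.zpowers g := ⟨g, Subgroup.mem_zpowers g⟩
  have hσ : ∀ᵐ x ∂μ, σ k x = ψ k x := by
    filter_upwards [hYae] with x hx using if_pos hx
  refine ⟨⟨σ k, mem_Gmp_of_ae_eq (Measurable.ite hYm (hψ k).measurable measurable_id) (hψ k) hσ⟩, ?_⟩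
  filter_upwards [hσ, hψη k] with x h1 h2
  exact h1.trans h2.symm

lemma measure_image_Gmp [StandardBorelSpace X] (φ : Gmp μ) {B : Set X} (hB : MeasurableSet B) :
    MeasurableSet (φ.1 '' B) ∧ μ (φ.1 '' B) = μ B := by
  have h : MeasurePreserving φ.1.symm μ μ := (φ⁻¹ : Gmp μ).2
  rw [Equiv.image_eq_preimage_symm]
  exact ⟨h.measurable hB, h.measure_preimage hB.nullMeasurableSet⟩

/-- If every homomorphism of `G` to `Aut μ` lifts, then every near-action has a spatial model. -/
lemma hasSpatialModel_of_exists_lift [StandardBorelSpace X]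
    (hf : ∀ f : G →* Aut μ, ∃ h : G →* Gmp μ, (toAut μ).comp h = f) (hη : IsNearAction μ η) :
    HasSpatialModelByBorelAutomorphisms μ η := by
  choose φ hφ using hη.exists_Gmp
  let f : G →* Aut μ := MonoidHom.mk' (fun g => toAut μ (φ g)) fun g h => by
    rw [← map_mul]
    refine toAut_eq_iff.2 ?_
    have hφh : MeasurePreserving (φ h).1 μ μ := (φ h).2
    filter_upwards [hη.mul_ae g h, hφ (g * h), hφ h,
      hφh.quasiMeasurePreserving.ae (hφ g)] with x h1 h2 h3 h4
    show (φ (g * h)).1 x = (φ g).1 ((φ h).1 x)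
    rw [h4, h3, ← h1, h2]
  obtain ⟨h, hh⟩ := hf f
  refine ⟨fun g => (h g).1, ⟨⟨fun x => by simp, fun g k x => by simp,
    fun g B hB => (measure_image_Gmp (h g) hB).1.nullMeasurableSet,
    fun g B hB => (measure_image_Gmp (h g) hB).2⟩, fun g => ?_⟩,
    fun g => MeasurePreserving.measurable (h g).2⟩
  have hg : toAut μ (h g) = toAut μ (φ g) := DFunLike.congr_fun hh g
  filter_upwards [toAut_eq_iff.1 hg, hφ g] with x h1 h2
  rw [h1, h2]

/-- If every near-action of `G` has a spatial model, then every homomorphism to `Aut μ` lifts. -/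
lemma exists_lift_of_hasSpatialModel [StandardBorelSpace X]
    (hG : ∀ η : G → X → X, IsNearAction μ η → HasSpatialModelByBorelAutomorphisms μ η)
    (f : G →* Aut μ) : ∃ h : G →* Gmp μ, (toAut μ).comp h = f := by
  choose φ hφ using fun g : G => QuotientGroup.mk'_surjective (Imp μ) (f g)
  have hφ1 : toAut μ (φ 1) = toAut μ 1 := by rw [hφ, map_one, map_one]
  have hφmul : ∀ g h, toAut μ (φ (g * h)) = toAut μ (φ g * φ h) := fun g h => by
    rw [map_mul, hφ, hφ, hφ, map_mul]
  obtain ⟨ρ, ⟨⟨hρ1, hρmul, -, -⟩, hρη⟩, hρm⟩ := hG (fun g => (φ g).1)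
    ⟨toAut_eq_iff.1 hφ1, fun g h => toAut_eq_iff.1 (hφmul g h),
      fun g B hB => (measure_image_Gmp (φ g) hB).1.nullMeasurableSet,
      fun g B hB => (measure_image_Gmp (φ g) hB).2⟩
  let σ : G →* Equiv.Perm X := permHomOfAction ρ hρ1 hρmul
  let h : G →* Gmp μ := σ.codRestrict (Gmp μ) fun g =>
    mem_Gmp_of_ae_eq (hρm g) (φ g).2 (by filter_upwards [hρη g] with x hx using hx.symm)
  refine ⟨h, MonoidHom.ext fun g => ?_⟩
  rw [← hφ g]
  exact toAut_eq_iff.2 (by filter_upwards [hρη g] with x hx using hx.symm)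

end NearActions

end NearAction

open NearAction in
theorem theorem2 {G : Type*} [Group G] {X : Type*} [MeasurableSpace X] [StandardBorelSpace X]
    (μ : Measure X) [IsProbabilityMeasure μ] :
    (Cardinal.mk G ≤ Cardinal.aleph 1 →
      (∀ η : G → X → X, IsNearAction μ η → HasSpatialModelByBorelAutomorphisms μ η) ∧
      (∀ f : G →* Aut μ, ∃ h : G →* Gmp μ, (toAut μ).comp h = f)) ∧
    ((∀ η : G → X → X, IsNearAction μ η → HasSpatialModelByBorelAutomorphisms μ η) ↔
      (∀ f : G →* Aut μ, ∃ h : G →* Gmp μ, (toAut μ).comp h = f)) ∧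
    (Cardinal.continuum.{0} = Cardinal.aleph.{0} 1 →
      ∀ η : G → X → X, IsNearAction μ η → HasSpatialModelByBorelAutomorphisms μ η) :=
  ⟨fun hG => ⟨fun _ => hasSpatialModel_of_exists_lift (exists_lift_of_card_le μ hG),
    exists_lift_of_card_le μ hG⟩,
    ⟨exists_lift_of_hasSpatialModel, fun hf _ => hasSpatialModel_of_exists_lift hf⟩,
    fun hCH _ => hasSpatialModel_of_exists_lift (exists_lift_of_continuum_eq μ hCH)⟩
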